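/- Let $f:\mathbb{C}[x,y]\to\mathbb{C}[x,y]$ be a $\mathbb{C}$-algebra endomorphism, put $p=f(x)$ and $q=f(y)$, and assume that the Jacobian determinant $\frac{\partial p}{\partial x}\frac{\partial q}{\partial y}-\frac{\partial p}{\partial y}\frac{\partial q}{\partial x}$ is a nonzero constant. Let $g$ be a $\mathbb{C}$-algebra automorphism of $\mathbb{C}[x,y]$, and put $g_1=g(x)$ and $g_2=g(y)$. Then there are $u_g\in\mathbb{C}[p,q,g_1]\setminus\{0\}$ and $v_g\in\mathbb{C}[p,q]\setminus\{0\}$ with $g_2=u_g/v_g$. Moreover, for every such pair $(u_g,v_g)$: if the group of invertible elements of the subring $\mathbb{C}[p,q,g_1][1/v_g]$ of $\mathbb{C}(x,y)$ is contained in $\mathbb{C}(p,q)\setminus\{0\}$, then $f$ is an automorphism of $\mathbb{C}[x,y]$. -/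

import Mathlib

/-- The Jacobian determinant `∂p/∂x * ∂q/∂y - ∂p/∂y * ∂q/∂x` of two polynomials in `ℂ[x,y]`,
where `x = X 0` and `y = X 1`. -/
noncomputable def jac (p q : MvPolynomial (Fin 2) ℂ) : MvPolynomial (Fin 2) ℂ :=
  (Matrix.of fun i j : Fin 2 => MvPolynomial.pderiv j ((![p, q] : Fin 2 → _) i)).det

/-- The field `ℂ(x,y)` of rational functions. -/
abbrev RatFun2 : Type := FractionRing (MvPolynomial (Fin 2) ℂ)

/-- The inclusion `ℂ[x,y] ⊂ ℂ(x,y)`. -/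
noncomputable abbrev toRat (a : MvPolynomial (Fin 2) ℂ) : RatFun2 :=
  algebraMap (MvPolynomial (Fin 2) ℂ) RatFun2 a

/-- The subring `ℂ[p,q,w][1/v]` of `ℂ(x,y)`. -/
noncomputable def ringInv (p q w v : MvPolynomial (Fin 2) ℂ) : Subalgebra ℂ RatFun2 :=
  Algebra.adjoin ℂ {toRat p, toRat q, toRat w, (toRat v)⁻¹}

/-- The subfield `ℂ(p,q)` of `ℂ(x,y)`. -/
noncomputable def fieldPQ (p q : MvPolynomial (Fin 2) ℂ) : IntermediateField ℂ RatFun2 :=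
  IntermediateField.adjoin ℂ {toRat p, toRat q}

/-- `u / v` is a presentation of `h` as a quotient of a nonzero element `u` of `ℂ[p,q,w]` by a
nonzero element `v` of `ℂ[p,q]`. -/
structure IsQuotientPresentation (p q w h u v : MvPolynomial (Fin 2) ℂ) : Prop where
  num_mem : u ∈ Algebra.adjoin ℂ ({p, q, w} : Set (MvPolynomial (Fin 2) ℂ))
  num_ne_zero : u ≠ 0
  den_mem : v ∈ Algebra.adjoin ℂ ({p, q} : Set (MvPolynomial (Fin 2) ℂ))
  den_ne_zero : v ≠ 0
  eq_div : toRat h = toRat u / toRat v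

/-! Existence of the fraction. Over k = ℂ(x) the Jacobian identity makes the y-derivatives of p and
q coprime, and a Lüroth-type argument (`X_mem_of_isCoprime_derivative`) then puts y in k(p,q). So y
is a fraction over ℂ[p,q,x]. Its denominator is algebraic over ℂ[p,q], hence can be traded for one
in ℂ[p,q]. Replacing f by g⁻¹∘f turns this into the statement for g₁ and g₂.

Bijectivity. Let F generate the ideal of polynomials over ℂ[p,q] vanishing at g₁, and let δ =
F'(g₁). Since g₂ = u/v, the ring ℂ[p,q,g₁][1/v] contains ℂ[x,y]. The invertible Jacobian forces δ to
divide a power of v (`exists_dvd_pow_of_mul_eq`), so δ is invertible there and lies in ℂ(p,q) by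
hypothesis. If deg F ≥ 2, then F' − δ is a nonzero relation for g₁ of smaller degree, which is
absurd. Hence g₁, and with it g₂ = u/v, lies in ℂ(p,q).

Finally ℂ(p,q) ∩ ℂ[x,y] = ℂ[p,q] (`mem_range_of_mul_eq`): a prime factor of a reduced denominator
would define a curve on which p and q are constant, hence would divide the Jacobian. -/

/-! ### A Lüroth-type argument in k(X) -/

open scoped Polynomial.Bivariate in
/-- The degree of a coefficient of a bivariate polynomial is at most the degree in the inner
variable. -/
theorem natDegree_coeff_le_natDegree_swap {R : Type*} [CommRing R]
    (M : Polynomial (Polynomial R)) (i : ℕ) :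
    (M.coeff i).natDegree ≤ (Polynomial.Bivariate.swap M).natDegree := by
  have key : ∀ (N : Polynomial (Polynomial R)) (a b : ℕ),
      ((Polynomial.Bivariate.swap N).coeff a).coeff b = (N.coeff b).coeff a := by
    intro N a b
    induction N using Polynomial.induction_on' with
    | add p q hp hq => simp [hp, hq]
    | monomial n f =>
      rw [Polynomial.Bivariate.swap_monomial, Polynomial.coeff_mul_C, Polynomial.coeff_map,
        Polynomial.coeff_C_mul, Polynomial.coeff_X_pow, Polynomial.coeff_monomial]
      by_cases h : b = n
      · simp [h]
      · simp [h, Ne.symm h]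
  rw [Polynomial.natDegree_le_iff_coeff_eq_zero]
  intro N hN
  rw [← key, Polynomial.coeff_eq_zero_of_natDegree_lt hN, Polynomial.coeff_zero]

/-- A subfield of `k(X)` containing `k` and two polynomials whose derivatives are coprime is all
of `k(X)`. -/
theorem X_mem_of_isCoprime_derivative {k : Type*} [Field k] [CharZero k] {E : Type*} [Field E]
    [Algebra k E] [Algebra (Polynomial k) E] [IsScalarTower k (Polynomial k) E]
    [IsFractionRing (Polynomial k) E] (F : IntermediateField k E) (p q : Polynomial k)
    (hp : algebraMap (Polynomial k) E p ∈ F) (hq : algebraMap (Polynomial k) E q ∈ F)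
    (hpq : IsCoprime p.derivative q.derivative) :
    algebraMap (Polynomial k) E Polynomial.X ∈ F := by
  wlog hp0 : p.derivative ≠ 0 generalizing p q
  · refine this q p hq hp hpq.symm fun h => ?_
    rw [not_not] at hp0
    rw [hp0, h] at hpq
    exact not_isCoprime_zero_zero hpq
  set x : E := algebraMap (Polynomial k) E Polynomial.X with hx
  have hinj : Function.Injective (algebraMap (Polynomial k) E) := IsFractionRing.injective _ _
  -- the difference polynomial `a(T) - a(X)`, over `F` and over `k[X]`
  let dF : ∀ a : F, Polynomial k → Polynomial F := fun a r =>
    r.map (algebraMap k F) - Polynomial.C a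
  let dP : Polynomial k → Polynomial (Polynomial k) := fun r =>
    r.map Polynomial.C - Polynomial.C r
  have hcomp : ∀ r : Polynomial k, ∀ hr : algebraMap (Polynomial k) E r ∈ F,
      (dF ⟨_, hr⟩ r).map (algebraMap F E) = (dP r).map (algebraMap (Polynomial k) E) := by
    intro r hr
    simp only [dF, dP, Polynomial.map_sub, Polynomial.map_map, Polynomial.map_C]
    congr 2
    ext a
    simp only [RingHom.comp_apply]
    rw [← Polynomial.algebraMap_eq, ← IsScalarTower.algebraMap_apply,
      ← IsScalarTower.algebraMap_apply]
  have haevalP : ∀ r : Polynomial k, (dP r).eval Polynomial.X = 0 := by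
    intro r
    simp [dP, Polynomial.eval_map, Polynomial.eval₂_C_X]
  have hdvd : ∀ r : Polynomial k, ∀ hr : algebraMap (Polynomial k) E r ∈ F,
      (minpoly F x).map (algebraMap F E) ∣ (dP r).map (algebraMap (Polynomial k) E) := by
    intro r hr
    rw [← hcomp r hr]
    refine Polynomial.map_dvd _ (minpoly.dvd _ _ ?_)
    rw [← Polynomial.eval_map_algebraMap, hcomp, hx, Polynomial.eval_map, Polynomial.eval₂_at_apply,
      haevalP, map_zero]
  have hlc : ∀ r : Polynomial k, r.natDegree ≠ 0 → (dP r).natDegree = r.natDegree ∧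
      (dP r).leadingCoeff = Polynomial.C r.leadingCoeff := by
    intro r hr
    have h1 : (dP r).natDegree = r.natDegree := by
      simp only [dP, Polynomial.natDegree_sub_C]
      exact Polynomial.natDegree_map_eq_of_injective Polynomial.C_injective r
    refine ⟨h1, ?_⟩
    rw [Polynomial.leadingCoeff, h1]
    simp [dP, Polynomial.coeff_C, hr]
  have hpdeg : p.natDegree ≠ 0 := fun h => hp0 (Polynomial.derivative_of_natDegree_zero h)
  have hplc : p.leadingCoeff ≠ 0 := by
    intro h
    rw [Polynomial.leadingCoeff_eq_zero] at h
    exact hp0 (by simp [h])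
  have hdp0 : dP p ≠ 0 := fun h => hpdeg (by rw [← (hlc p hpdeg).1, h, Polynomial.natDegree_zero])
  have hint : IsIntegral F x := by
    refine IsAlgebraic.isIntegral ⟨dF ⟨_, hp⟩ p, fun h => ?_, ?_⟩
    · have := hcomp p hp
      rw [h, Polynomial.map_zero] at this
      exact hdp0 ((Polynomial.map_eq_zero_iff hinj).1 this.symm)
    · rw [← Polynomial.eval_map_algebraMap, hcomp, hx, Polynomial.eval_map,
        Polynomial.eval₂_at_apply, haevalP, map_zero]
  -- the minimal polynomial has coefficients in `k[X]`
  obtain ⟨M, hM⟩ : ∃ M : Polynomial (Polynomial k),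
      M.map (algebraMap (Polynomial k) E) = (minpoly F x).map (algebraMap F E) := by
    -- Gauss's lemma: the minimal polynomial is a monic divisor of p(T) − p(X), which is monic over
    -- k[X] up to a constant.
    have hu : (Polynomial.C (Polynomial.C p.leadingCoeff⁻¹) * dP p).Monic := by
      rw [Polynomial.Monic, Polynomial.leadingCoeff_mul, (hlc p hpdeg).2,
        Polynomial.leadingCoeff_C, ← Polynomial.C_mul, inv_mul_cancel₀ hplc, Polynomial.C_1]
    obtain ⟨M, hM⟩ := IsIntegrallyClosed.eq_map_mul_C_of_dvd E hu
      (g := (minpoly F x).map (algebraMap F E))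
      (by rw [Polynomial.map_mul]; exact (hdvd p hp).mul_left _)
    refine ⟨M, ?_⟩
    rwa [((minpoly.monic hint).map _).leadingCoeff, Polynomial.C_1, mul_one] at hM
  have hMmonic : M.Monic :=
    Polynomial.monic_of_injective hinj (hM ▸ (minpoly.monic hint).map _)
  have hMx : M.eval Polynomial.X = 0 := by
    apply hinj
    rw [map_zero, ← Polynomial.eval₂_at_apply, ← Polynomial.eval_map, hM,
      Polynomial.eval_map_algebraMap, minpoly.aeval]
  have hMdvd : ∀ r : Polynomial k, algebraMap (Polynomial k) E r ∈ F → M ∣ dP r := by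
    intro r hr
    have := hdvd r hr
    rw [← hM] at this
    exact (Polynomial.map_dvd_map _ hinj hMmonic).1 this
  have hcoeff : ∀ i, algebraMap (Polynomial k) E (M.coeff i) ∈ F := by
    intro i
    have := congrArg (fun P => Polynomial.coeff P i) hM
    simp only [Polynomial.coeff_map] at this
    rw [this]
    exact ((minpoly F x).coeff i).2
  -- With constant coefficients, `M` would be an algebraic relation for X over k.
  obtain ⟨i, hi⟩ : ∃ i, (M.coeff i).natDegree ≠ 0 := by
    by_contra! h
    have hM' : M = (M.map (Polynomial.evalRingHom 0)).map Polynomial.C := by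
      ext1 i
      rw [Polynomial.coeff_map, Polynomial.coeff_map, Polynomial.eq_C_of_natDegree_eq_zero (h i)]
      simp
    rw [hM', Polynomial.eval_map, Polynomial.eval₂_C_X] at hMx
    rw [hMx, Polynomial.map_zero] at hM'
    exact hMmonic.ne_zero hM'
  set h := M.coeff i with hh
  obtain ⟨s, hs⟩ := hMdvd h (hcoeff i)
  have hdh0 : dP h ≠ 0 := fun h0 => hi (by rw [← (hlc h hi).1, h0, Polynomial.natDegree_zero])
  have hs0 : s ≠ 0 := by rintro rfl; exact hdh0 (by rw [hs, mul_zero])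
  have hswap : Polynomial.Bivariate.swap (dP h) = - dP h := by
    simp only [dP]
    rw [map_sub, Polynomial.Bivariate.swap_map_C, Polynomial.Bivariate.swap_C]
    ring
  have hsw0 : ∀ N : Polynomial (Polynomial k), N ≠ 0 → Polynomial.Bivariate.swap N ≠ 0 :=
    fun N hN => (map_ne_zero_iff _ Polynomial.Bivariate.swap.injective).2 hN
  -- Compare degrees in X: h(T) − h(X) has degree deg h, and `M` already has at least that because
  -- `h` is one of its coefficients.
  have hsdeg : (Polynomial.Bivariate.swap s).natDegree = 0 := by
    have h1 := congrArg (fun P => (Polynomial.Bivariate.swap P).natDegree) hs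
    simp only [hswap, map_mul, Polynomial.natDegree_neg] at h1
    rw [Polynomial.natDegree_mul (hsw0 _ hMmonic.ne_zero) (hsw0 _ hs0), (hlc h hi).1] at h1
    have h2 : h.natDegree ≤ _ := natDegree_coeff_le_natDegree_swap M i
    omega
  obtain ⟨s₀, hs₀⟩ : ∃ s₀, Polynomial.Bivariate.swap s = Polynomial.C s₀ :=
    ⟨_, Polynomial.eq_C_of_natDegree_eq_zero hsdeg⟩
  have hsunit : IsUnit s := by
    -- By antisymmetry of h(T) − h(X), `s₀` divides each of its coefficients, among them the
    -- constant leading one.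
    have h1 : Polynomial.C s₀ ∣ dP h := by
      rw [← hs₀, ← neg_neg (dP h), ← hswap, hs, map_mul]
      exact (Dvd.intro_left _ rfl).neg_right
    have h2 := (Polynomial.C_dvd_iff_dvd_coeff _ _).1 h1 (dP h).natDegree
    have h3 : IsUnit s₀ := by
      refine isUnit_of_dvd_unit h2 ?_
      rw [Polynomial.coeff_natDegree, (hlc h hi).2]
      refine Polynomial.isUnit_C.2 (IsUnit.mk0 _ ?_)
      rw [Ne, Polynomial.leadingCoeff_eq_zero]
      intro h0
      simp [h0] at hi
    have h4 : IsUnit (Polynomial.Bivariate.swap s) := hs₀ ▸ Polynomial.isUnit_C.2 h3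
    exact (MulEquiv.isUnit_map Polynomial.Bivariate.swap).1 h4
  -- Differentiate in T and set T = X, where `M` vanishes.
  have hder : ∀ r t : Polynomial _, dP r = M * t →
      r.derivative = M.derivative.eval Polynomial.X * t.eval Polynomial.X := by
    intro r t hrt
    have h1 := congrArg (fun P => (Polynomial.derivative P).eval Polynomial.X) hrt
    simp only [Polynomial.derivative_mul, Polynomial.eval_add, Polynomial.eval_mul, hMx, zero_mul,
      add_zero] at h1
    rw [← h1]
    simp [dP, Polynomial.derivative_map, Polynomial.eval_map, Polynomial.eval₂_C_X]
  have hunit : IsUnit (M.derivative.eval Polynomial.X) := by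
    obtain ⟨a, ha⟩ := hMdvd p hp
    obtain ⟨b, hb⟩ := hMdvd q hq
    exact hpq.isUnit_of_dvd' (Dvd.intro _ (hder p a ha).symm) (Dvd.intro _ (hder q b hb).symm)
  have hh1 : h.natDegree = 1 := by
    have h1 : IsUnit h.derivative := by
      rw [hder h s hs]
      exact hunit.mul (hsunit.map (Polynomial.evalRingHom Polynomial.X))
    have h2 := Polynomial.natDegree_eq_zero_of_isUnit h1
    rw [Polynomial.natDegree_derivative] at h2
    omega
  have hM1 : M.natDegree ≤ 1 := by
    have := congrArg Polynomial.natDegree hs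
    rw [Polynomial.natDegree_mul hMmonic.ne_zero hs0, (hlc h hi).1, hh1] at this
    omega
  have hmin : (minpoly F x).natDegree = 1 := by
    refine le_antisymm ?_ (minpoly.natDegree_pos hint)
    rw [← Polynomial.natDegree_map (algebraMap F E), ← hM]
    exact (Polynomial.natDegree_map_le).trans hM1
  obtain ⟨y, hy⟩ := minpoly.mem_range_of_degree_eq_one F x
    ((Polynomial.degree_eq_iff_natDegree_eq_of_pos one_pos).2 hmin)
  rw [← hy]
  exact y.2

/-! ### Jacobian determinants and injectivity -/

theorem jac_eq (p q : MvPolynomial (Fin 2) ℂ) :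
    jac p q = MvPolynomial.pderiv 0 p * MvPolynomial.pderiv 1 q -
      MvPolynomial.pderiv 1 p * MvPolynomial.pderiv 0 q := by
  simp [jac, Matrix.det_fin_two]

/-- The chain rule for an endomorphism of the polynomial ring in two variables. -/
theorem pderiv_algHom (f : MvPolynomial (Fin 2) ℂ →ₐ[ℂ] MvPolynomial (Fin 2) ℂ) (i : Fin 2)
    (P : MvPolynomial (Fin 2) ℂ) :
    MvPolynomial.pderiv i (f P) =
      f (MvPolynomial.pderiv 0 P) * MvPolynomial.pderiv i (f (MvPolynomial.X 0)) +
      f (MvPolynomial.pderiv 1 P) * MvPolynomial.pderiv i (f (MvPolynomial.X 1)) := by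
  induction P using MvPolynomial.induction_on with
  | C a =>
    have : f (MvPolynomial.C a) = MvPolynomial.C a := f.commutes a
    simp [this]
  | add p q hp hq => simp only [map_add, hp, hq]; ring
  | mul_X p j hp =>
    fin_cases j <;>
    simp [hp, MvPolynomial.pderiv_X] <;> ring

/-- The chain rule is a matrix product. When the left side is invertible, both factors on the right
are. -/
theorem jac_algHom (f : MvPolynomial (Fin 2) ℂ →ₐ[ℂ] MvPolynomial (Fin 2) ℂ)
    (P Q : MvPolynomial (Fin 2) ℂ) :
    jac (f P) (f Q) = f (jac P Q) * jac (f (MvPolynomial.X 0)) (f (MvPolynomial.X 1)) := by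
  simp only [jac_eq, map_sub, map_mul, pderiv_algHom f _ P, pderiv_algHom f _ Q]
  ring

theorem exists_pderiv_ne_zero {H : MvPolynomial (Fin 2) ℂ} (hH : H.totalDegree ≠ 0) :
    ∃ i, MvPolynomial.pderiv i H ≠ 0 ∧ (MvPolynomial.pderiv i H).totalDegree < H.totalDegree := by
  obtain ⟨m, hm, i, hi⟩ : ∃ m ∈ H.support, ∃ i, m i ≠ 0 := by
    by_contra! h
    exact hH ((MvPolynomial.totalDegree_eq_zero_iff _ _).2 fun m hm i => h m hm i)
  refine ⟨i, fun h0 => ?_, ?_⟩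
  · have h1 := congrArg (MvPolynomial.coeff (m - Finsupp.single i 1)) h0
    have h2 : m - Finsupp.single i 1 + Finsupp.single i 1 = m :=
      tsub_add_cancel_of_le (by simpa using Nat.one_le_iff_ne_zero.2 hi)
    rw [MvPolynomial.coeff_pderiv, h2, MvPolynomial.coeff_zero, mul_eq_zero] at h1
    rcases h1 with h1 | h1
    · exact MvPolynomial.mem_support_iff.1 hm h1
    · exact Nat.cast_add_one_ne_zero _ h1
  · refine (Finset.sup_lt_iff (Nat.pos_of_ne_zero hH)).2 fun m hm => ?_
    rw [MvPolynomial.mem_support_iff, MvPolynomial.coeff_pderiv] at hm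
    have h1 := MvPolynomial.le_totalDegree (MvPolynomial.mem_support_iff.2 (left_ne_zero_of_mul hm))
    rw [Finsupp.sum_add_index' (fun _ => rfl) (fun _ _ _ => rfl), Finsupp.sum_single_index rfl] at h1
    exact Nat.lt_of_succ_le h1

/-- An endomorphism with nonzero Jacobian determinant is injective. -/
theorem injective_of_jac_ne_zero (f : MvPolynomial (Fin 2) ℂ →ₐ[ℂ] MvPolynomial (Fin 2) ℂ)
    (hf : jac (f (MvPolynomial.X 0)) (f (MvPolynomial.X 1)) ≠ 0) : Function.Injective f := by
  rw [injective_iff_map_eq_zero]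
  suffices ∀ n (H : MvPolynomial (Fin 2) ℂ), H.totalDegree = n → f H = 0 → H = 0 from
    fun H hH => this _ H rfl hH
  intro n
  induction n using Nat.strong_induction_on with
  | _ n ih =>
    intro H hn hH
    by_cases h0 : H.totalDegree = 0
    · rw [MvPolynomial.totalDegree_eq_zero_iff_eq_C] at h0
      rw [h0] at hH ⊢
      have h1 : f (MvPolynomial.C (MvPolynomial.coeff 0 H)) =
        MvPolynomial.C (MvPolynomial.coeff 0 H) := f.commutes _
      rw [← h1, hH]
    · exfalso
      obtain ⟨i, hi, hlt⟩ := exists_pderiv_ne_zero h0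
      refine hi (ih _ (hn ▸ hlt) _ rfl ?_)
      -- Cramer's rule: the Jacobian matrix is nonsingular, so `f` kills both partial derivatives of
      -- `H`, one of which is nonzero of smaller degree.
      have e0 := pderiv_algHom f 0 H
      have e1 := pderiv_algHom f 1 H
      rw [hH, map_zero] at e0 e1
      rw [jac_eq] at hf
      obtain rfl | rfl : i = 0 ∨ i = 1 := by fin_cases i <;> simp
      · refine (mul_eq_zero_iff_right hf).1 ?_
        linear_combination (-MvPolynomial.pderiv 1 (f (MvPolynomial.X 1))) * e0 +
          MvPolynomial.pderiv 0 (f (MvPolynomial.X 1)) * e1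
      · refine (mul_eq_zero_iff_right hf).1 ?_
        linear_combination (MvPolynomial.pderiv 1 (f (MvPolynomial.X 0))) * e0 -
          MvPolynomial.pderiv 0 (f (MvPolynomial.X 0)) * e1

/-! ### Algebraic relations over the image of an endomorphism -/

/-- The polynomial ring is algebraic over the image of an injective endomorphism. -/
theorem exists_eval₂_eq_zero (f : MvPolynomial (Fin 2) ℂ →ₐ[ℂ] MvPolynomial (Fin 2) ℂ)
    (hf : Function.Injective f) (b : MvPolynomial (Fin 2) ℂ) :
    ∃ F : Polynomial (MvPolynomial (Fin 2) ℂ), F ≠ 0 ∧ F.eval₂ (f : _ →+* _) b = 0 := by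
  have hind : AlgebraicIndependent ℂ fun i => f (MvPolynomial.X i) := by
    have h1 : MvPolynomial.aeval (fun i => f (MvPolynomial.X i)) = f := by
      ext i; simp
    rw [AlgebraicIndependent, h1]
    exact hf
  have hb := hind.isTranscendenceBasis_of_trdeg_le_of_finite
    (by rw [MvPolynomial.trdeg_of_isDomain]; simp)
  obtain ⟨P, hP0, hP⟩ := hb.isAlgebraic.isAlgebraic b
  let e := hind.aevalEquiv
  refine ⟨P.map (e.symm : _ →+* _), ?_, ?_⟩
  · rwa [Ne, Polynomial.map_eq_zero_iff e.symm.injective]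
  · rw [Polynomial.eval₂_map, ← hP, Polynomial.aeval_def]
    congr 1
    ext1 y
    obtain ⟨y, rfl⟩ := e.surjective y
    have h2 : algebraMap _ (MvPolynomial (Fin 2) ℂ) (e y) = f y := by
      rw [AlgebraicIndependent.algebraMap_aevalEquiv]
      congr 1
      ext i; simp
    rw [h2]
    simp

/-- The polynomials over a factorial domain that vanish at a fixed algebraic element form a
principal ideal. -/
theorem exists_generator_of_eval₂_eq_zero {A B : Type*} [CommRing A] [IsDomain A]
    [UniqueFactorizationMonoid A] [CommRing B] [IsDomain B] (φ : A →+* B)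
    (hφ : Function.Injective φ) (b : B)
    (hb : ∃ F : Polynomial A, F ≠ 0 ∧ F.eval₂ φ b = 0) :
    ∃ F : Polynomial A, F ≠ 0 ∧ F.eval₂ φ b = 0 ∧
      ∀ G : Polynomial A, G.eval₂ φ b = 0 → F ∣ G := by
  classical
  obtain ⟨F₀, hF₀, hF₀b⟩ := hb
  let I : Ideal (Polynomial A) := RingHom.ker (Polynomial.eval₂RingHom φ b)
  have hI : I.IsPrime := RingHom.ker_isPrime _
  have hIm : ∀ G : Polynomial A, G ∈ I ↔ G.eval₂ φ b = 0 := fun G => Iff.rfl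
  obtain ⟨π, hπI, hπ⟩ := hI.exists_mem_prime_of_ne_bot
    (fun h => hF₀ (by rw [← Ideal.mem_bot, ← h]; exact hF₀b))
  rw [hIm] at hπI
  refine ⟨π, hπ.ne_zero, hπI, fun G hG => ?_⟩
  let : NormalizedGCDMonoid A := Nonempty.some inferInstance
  have hdeg : π.natDegree ≠ 0 := by
    intro h
    rw [Polynomial.eq_C_of_natDegree_eq_zero h, Polynomial.eval₂_C,
      map_eq_zero_iff φ hφ] at hπI
    apply hπ.ne_zero
    rw [Polynomial.eq_C_of_natDegree_eq_zero h, hπI, Polynomial.C_0]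
  have hprim : π.IsPrimitive := hπ.irreducible.isPrimitive hdeg
  refine hprim.dvd_of_fraction_map_dvd_fraction_map (K := FractionRing A) ?_
  have hirr := (hprim.irreducible_iff_irreducible_map_fraction_map (K := FractionRing A)).1
    hπ.irreducible
  -- If the two were coprime over the fraction field, clearing denominators in a Bézout relation and
  -- evaluating at `b` would kill a nonzero constant.
  refine ((dvd_or_isCoprime _ _ hirr).symm).resolve_left fun hcop => ?_
  obtain ⟨a, c, hac⟩ := hcop
  obtain ⟨d, hd, hda⟩ := IsLocalization.integerNormalization_spec (nonZeroDivisors A) a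
  obtain ⟨e, he, hec⟩ := IsLocalization.integerNormalization_spec (nonZeroDivisors A) c
  have h1 : Polynomial.C e * IsLocalization.integerNormalization (nonZeroDivisors A) a * π +
      Polynomial.C d * IsLocalization.integerNormalization (nonZeroDivisors A) c * G =
      Polynomial.C (d * e) := by
    apply Polynomial.map_injective (algebraMap A (FractionRing A)) (IsFractionRing.injective _ _)
    simp only [Polynomial.map_add, Polynomial.map_mul, hda, hec, Polynomial.map_C, map_mul,
      Algebra.smul_def, Polynomial.algebraMap_apply]
    linear_combination (Polynomial.C (algebraMap A (FractionRing A) d) *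
      Polynomial.C (algebraMap A (FractionRing A) e)) * hac
  have h2 := congrArg (Polynomial.eval₂ φ b) h1
  simp only [Polynomial.eval₂_add, Polynomial.eval₂_mul, hπI, hG, mul_zero, add_zero,
    Polynomial.eval₂_C] at h2
  exact mul_ne_zero (nonZeroDivisors.ne_zero hd) (nonZeroDivisors.ne_zero he)
    ((map_eq_zero_iff φ hφ).1 h2.symm)

/-- If `v * y = U(x)`, then a power of `v` times a polynomial expression in `x` and `y` lifts
to a polynomial in `x` alone, with the expected derivative. -/
theorem exists_lift_of_mul_eq {A B : Type*} [CommRing A] [CommRing B] [Algebra ℂ A] [Algebra ℂ B]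
    (φ : A →ₐ[ℂ] B) (γ : MvPolynomial (Fin 2) ℂ →ₐ[ℂ] B) (V : A) (U : Polynomial A)
    (hU : φ V * γ (MvPolynomial.X 1) = U.eval₂ (φ : A →+* B) (γ (MvPolynomial.X 0)))
    (P : MvPolynomial (Fin 2) ℂ) :
    ∃ (N : ℕ) (G : Polynomial A),
      G.eval₂ (φ : A →+* B) (γ (MvPolynomial.X 0)) = φ V ^ N * γ P ∧
      φ V * G.derivative.eval₂ (φ : A →+* B) (γ (MvPolynomial.X 0)) =
        φ V ^ N * (φ V * γ (MvPolynomial.pderiv 0 P) +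
          γ (MvPolynomial.pderiv 1 P) *
            U.derivative.eval₂ (φ : A →+* B) (γ (MvPolynomial.X 0))) := by
  induction P using MvPolynomial.induction_on with
  | C a =>
    refine ⟨0, Polynomial.C (algebraMap ℂ A a), ?_, ?_⟩
    · rw [← MvPolynomial.algebraMap_eq]
      simp
    · simp
  | add p q hp hq =>
    obtain ⟨N, G, h1, h2⟩ := hp
    obtain ⟨N', G', h1', h2'⟩ := hq
    refine ⟨N + N', Polynomial.C (V ^ N') * G + Polynomial.C (V ^ N) * G', ?_, ?_⟩
    · simp only [Polynomial.eval₂_add, Polynomial.eval₂_mul, Polynomial.eval₂_C, h1, h1']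
      simp only [RingHom.coe_coe, map_pow, map_add]
      ring
    · simp only [Polynomial.derivative_add, Polynomial.derivative_C_mul, Polynomial.eval₂_add,
        Polynomial.eval₂_mul, Polynomial.eval₂_C]
      simp only [RingHom.coe_coe, map_pow, map_add]
      linear_combination φ V ^ N' * h2 + φ V ^ N * h2'
  | mul_X p j hp =>
    obtain ⟨N, G, h1, h2⟩ := hp
    fin_cases j
    · refine ⟨N, G * Polynomial.X, ?_, ?_⟩
      · simp only [Polynomial.eval₂_mul, Polynomial.eval₂_X, h1, map_mul, Fin.zero_eta]
        ring
      · simp [Polynomial.eval₂_mul, MvPolynomial.pderiv_X, h1]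
        linear_combination γ (MvPolynomial.X 0) * h2
    -- Each factor y is replaced by U/V, at the cost of one more power of `V`.
    · refine ⟨N + 1, G * U, ?_, ?_⟩
      · simp only [Polynomial.eval₂_mul, h1, ← hU, map_mul, Fin.mk_one]
        ring
      · simp [Polynomial.eval₂_mul, MvPolynomial.pderiv_X, h1, ← hU]
        linear_combination φ V * γ (MvPolynomial.X 1) * h2

/-! ### Polynomials in ℂ(p,q) lie in ℂ[p,q] -/

/-- A prime polynomial dividing the images of two coprime polynomials divides `f(x) - c` and
`f(y) - d` for some constants `c` and `d`. -/
theorem exists_forall_dvd_sub_C (f : MvPolynomial (Fin 2) ℂ →ₐ[ℂ] MvPolynomial (Fin 2) ℂ)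
    {β a d : MvPolynomial (Fin 2) ℂ} (hβ : Prime β) (hd : d ≠ 0) (had : IsRelPrime a d)
    (ha : β ∣ f a) (hfd : β ∣ f d) :
    ∃ c : Fin 2 → ℂ, ∀ i, β ∣ f (MvPolynomial.X i) - MvPolynomial.C (c i) := by
  have hspan : (Ideal.span {β}).IsPrime := (Ideal.span_singleton_prime hβ.ne_zero).2 hβ
  let P : Ideal (MvPolynomial (Fin 2) ℂ) := (Ideal.span {β}).comap f
  have hP : P.IsPrime := Ideal.IsPrime.comap f
  have hPm : ∀ r, r ∈ P ↔ β ∣ f r := fun r => by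
    simp [P, Ideal.mem_comap, Ideal.mem_span_singleton]
  obtain ⟨π, hπP, hπ⟩ := hP.exists_mem_prime_of_ne_bot
    (fun h => hd (by rw [← Ideal.mem_bot, ← h]; exact (hPm d).2 hfd))
  have hπspan : (Ideal.span {π}).IsPrime := (Ideal.span_singleton_prime hπ.ne_zero).2 hπ
  have hlt₁ : (⊥ : Ideal (MvPolynomial (Fin 2) ℂ)) < Ideal.span {π} :=
    bot_lt_iff_ne_bot.2 fun h => hπ.ne_zero (Ideal.span_singleton_eq_bot.1 h)
  have hlt₂ : Ideal.span {π} < P := by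
    refine lt_of_le_of_ne ((Ideal.span_singleton_le_iff_mem _).2 hπP) fun h => hπ.not_isUnit ?_
    refine had ?_ ?_
    · rw [← Ideal.mem_span_singleton, h]; exact (hPm a).2 ha
    · rw [← Ideal.mem_span_singleton, h]; exact (hPm d).2 hfd
  have hmax : P.IsMaximal := by
    obtain ⟨M, hM, hPM⟩ := P.exists_le_maximal hP.ne_top
    rcases eq_or_lt_of_le hPM with h | h
    · rwa [h]
    exfalso
    -- A strictly larger maximal ideal would give a chain of four primes in a ring of dimension two.
    let S : LTSeries (PrimeSpectrum (MvPolynomial (Fin 2) ℂ)) :=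
      ⟨3, ![⟨⊥, Ideal.isPrime_bot⟩, ⟨_, hπspan⟩, ⟨P, hP⟩, ⟨M, hM.isPrime⟩], by
        intro i
        fin_cases i
        · exact hlt₁
        · exact hlt₂
        · exact h⟩
    have h1 : ((3 : ℕ) : WithBot ℕ∞) ≤ ringKrullDim (MvPolynomial (Fin 2) ℂ) :=
      Order.LTSeries.length_le_krullDim S
    rw [MvPolynomial.ringKrullDim_of_isNoetherianRing, ringKrullDim_eq_zero_of_field] at h1
    simp only [Nat.card_eq_fintype_card, Fintype.card_fin, zero_add] at h1
    have h2 : (3 : ℕ) ≤ 2 := by exact_mod_cast h1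
    omega
  obtain ⟨c, hc⟩ := MvPolynomial.isMaximal_iff_eq_vanishingIdeal_singleton.1 hmax
  refine ⟨c, fun i => ?_⟩
  have h1 : MvPolynomial.X i - MvPolynomial.C (c i) ∈ P := by
    rw [hc, MvPolynomial.mem_vanishingIdeal_singleton_iff]
    simp
  rw [hPm, map_sub] at h1
  have h2 : f (MvPolynomial.C (c i)) = MvPolynomial.C (c i) := f.commutes _
  rwa [h2] at h1

/-- Modulo β the gradients of p and q are both multiples of the gradient of β, so the Jacobian
matrix is singular. -/
theorem dvd_jac {β p q : MvPolynomial (Fin 2) ℂ} {c d : ℂ} (hp : β ∣ p - MvPolynomial.C c)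
    (hq : β ∣ q - MvPolynomial.C d) : β ∣ jac p q := by
  obtain ⟨m, hm⟩ := hp
  obtain ⟨n, hn⟩ := hq
  rw [sub_eq_iff_eq_add] at hm hn
  rw [jac_eq, hm, hn]
  simp only [map_add, MvPolynomial.pderiv_C, add_zero, MvPolynomial.pderiv_mul]
  refine ⟨MvPolynomial.pderiv 0 β * m * MvPolynomial.pderiv 1 n +
    MvPolynomial.pderiv 0 m * MvPolynomial.pderiv 1 β * n +
    β * MvPolynomial.pderiv 0 m * MvPolynomial.pderiv 1 n -
    (MvPolynomial.pderiv 1 β * m * MvPolynomial.pderiv 0 n +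
    MvPolynomial.pderiv 1 m * MvPolynomial.pderiv 0 β * n +
    β * MvPolynomial.pderiv 1 m * MvPolynomial.pderiv 0 n), ?_⟩
  ring

/-- A polynomial that is a fraction of elements of the image of an endomorphism with invertible
Jacobian determinant lies in the image. -/
theorem mem_range_of_mul_eq (f : MvPolynomial (Fin 2) ℂ →ₐ[ℂ] MvPolynomial (Fin 2) ℂ)
    (hf : IsUnit (jac (f (MvPolynomial.X 0)) (f (MvPolynomial.X 1))))
    {a b d : MvPolynomial (Fin 2) ℂ} (hd : d ≠ 0) (h : f d * b = f a) : b ∈ f.range := by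
  have hinj := injective_of_jac_ne_zero f hf.ne_zero
  obtain ⟨d', a', c, hrel, rfl, rfl⟩ := UniqueFactorizationMonoid.exists_reduced_factors d hd a
  have hc : f c ≠ 0 := by
    rw [Ne, map_eq_zero_iff f hinj]
    exact left_ne_zero_of_mul hd
  have h' : f d' * b = f a' := by
    apply mul_left_cancel₀ hc
    simpa [mul_assoc] using h
  by_cases hu : IsUnit d'
  · obtain ⟨e, he⟩ := hu.exists_left_inv
    refine ⟨e * a', ?_⟩
    change f (e * a') = b
    rw [map_mul, ← h', ← mul_assoc, ← map_mul, he, map_one, one_mul]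
  · exfalso
    have hfu : ¬ IsUnit (f d') := by
      intro h0
      obtain ⟨r, hr, hr'⟩ := MvPolynomial.isUnit_iff_eq_C_of_isReduced.1 h0
      have h2 : f (MvPolynomial.C r) = MvPolynomial.C r := f.commutes _
      rw [← h2] at hr'
      exact hu (hinj hr' ▸ hr.map MvPolynomial.C)
    have hd' : d' ≠ 0 := right_ne_zero_of_mul hd
    obtain ⟨β, hβ, hβd⟩ := WfDvdMonoid.exists_irreducible_factor hfu
      ((map_ne_zero_iff f hinj).2 hd')
    have hβa : β ∣ f a' := h' ▸ hβd.mul_right b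
    obtain ⟨c, hc⟩ := exists_forall_dvd_sub_C f hβ.prime hd' hrel.symm hβa hβd
    exact hβ.not_isUnit (isUnit_of_dvd_unit (dvd_jac (hc 0) (hc 1)) hf)

/-! ### Subalgebras as polynomial expressions -/

theorem range_eq_adjoin_pair {B : Type*} [CommRing B] [Algebra ℂ B]
    (γ : MvPolynomial (Fin 2) ℂ →ₐ[ℂ] B) :
    γ.range = Algebra.adjoin ℂ {γ (MvPolynomial.X 0), γ (MvPolynomial.X 1)} := by
  rw [← Algebra.map_top, ← MvPolynomial.adjoin_range_X, AlgHom.map_adjoin]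
  congr 1
  ext b
  simp [Fin.exists_fin_two, eq_comm]

theorem eval₂_mem {B : Type*} [CommRing B] [Algebra ℂ B] (S : Subalgebra ℂ B)
    (φ : MvPolynomial (Fin 2) ℂ →ₐ[ℂ] B) (h : φ.range ≤ S) {w : B} (hw : w ∈ S)
    (U : Polynomial (MvPolynomial (Fin 2) ℂ)) : U.eval₂ (φ : _ →+* B) w ∈ S := by
  rw [Polynomial.eval₂_eq_sum_range]
  exact sum_mem fun i _ => mul_mem (h ⟨_, rfl⟩) (pow_mem hw i)

theorem mem_adjoin_triple_iff {B : Type*} [CommRing B] [Algebra ℂ B]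
    (φ : MvPolynomial (Fin 2) ℂ →ₐ[ℂ] B) (w b : B) :
    b ∈ Algebra.adjoin ℂ {φ (MvPolynomial.X 0), φ (MvPolynomial.X 1), w} ↔
      ∃ U : Polynomial (MvPolynomial (Fin 2) ℂ), U.eval₂ (φ : _ →+* B) w = b := by
  constructor
  · intro h
    induction h using Algebra.adjoin_induction with
    | mem x hx =>
      rcases hx with rfl | rfl | rfl
      · exact ⟨Polynomial.C (MvPolynomial.X 0), by simp⟩
      · exact ⟨Polynomial.C (MvPolynomial.X 1), by simp⟩
      · exact ⟨Polynomial.X, by simp⟩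
    | algebraMap r => exact ⟨Polynomial.C (algebraMap _ _ r), by
        rw [Polynomial.eval₂_C, RingHom.coe_coe, AlgHom.commutes]⟩
    | add x y _ _ hx hy =>
      obtain ⟨U, rfl⟩ := hx
      obtain ⟨V, rfl⟩ := hy
      exact ⟨U + V, by simp⟩
    | mul x y _ _ hx hy =>
      obtain ⟨U, rfl⟩ := hx
      obtain ⟨V, rfl⟩ := hy
      exact ⟨U * V, by simp⟩
  · rintro ⟨U, rfl⟩
    refine eval₂_mem _ φ ?_ (Algebra.subset_adjoin (by simp)) U
    rw [range_eq_adjoin_pair]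
    exact Algebra.adjoin_mono (by intro; simp; tauto)

/-! ### The variable y as a fraction over ℂ[p,q,x] -/

/-- An embedding of `ℂ[x,y]` into `ℂ(x)[y]`. -/
noncomputable def polyOverRatFun : MvPolynomial (Fin 2) ℂ →+*
    Polynomial (FractionRing (MvPolynomial (Fin 1) ℂ)) :=
  (Polynomial.mapRingHom (algebraMap (MvPolynomial (Fin 1) ℂ) _)).comp
    -- `finSuccEquiv` singles out variable 0, so x and y are exchanged first.
    (((MvPolynomial.renameEquiv ℂ (Equiv.swap (0 : Fin 2) 1)).trans
      (MvPolynomial.finSuccEquiv ℂ 1) : _ →+* Polynomial (MvPolynomial (Fin 1) ℂ)))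

theorem polyOverRatFun_injective : Function.Injective polyOverRatFun :=
  (Polynomial.map_injective _ (IsFractionRing.injective _ _)).comp (AlgEquiv.injective _)

theorem polyOverRatFun_X_one : polyOverRatFun (MvPolynomial.X 1) = Polynomial.X := by
  simp [polyOverRatFun, MvPolynomial.finSuccEquiv_X_zero]

theorem polyOverRatFun_X_zero : polyOverRatFun (MvPolynomial.X 0) =
    Polynomial.C (algebraMap (MvPolynomial (Fin 1) ℂ) _ (MvPolynomial.X 0)) := by
  have h0 : MvPolynomial.finSuccEquiv ℂ 1 (MvPolynomial.X 1) =
    Polynomial.C (MvPolynomial.X 0) := MvPolynomial.finSuccEquiv_X_succ (j := 0)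
  simp [polyOverRatFun, h0]

theorem polyOverRatFun_C (a : ℂ) : polyOverRatFun (MvPolynomial.C a) =
    Polynomial.C (algebraMap (MvPolynomial (Fin 1) ℂ) _ (MvPolynomial.C a)) := by
  simp [polyOverRatFun, MvPolynomial.finSuccEquiv_apply]

theorem polyOverRatFun_rename (m : MvPolynomial (Fin 1) ℂ) :
    polyOverRatFun (MvPolynomial.rename (fun _ => 0) m) = Polynomial.C (algebraMap _ _ m) := by
  induction m using MvPolynomial.induction_on with
  | C a => rw [MvPolynomial.rename_C, polyOverRatFun_C]
  | add p q hp hq => rw [map_add, map_add, hp, hq, map_add, Polynomial.C_add]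
  | mul_X p j hp =>
    rw [Subsingleton.elim j 0, map_mul, map_mul, hp, MvPolynomial.rename_X, polyOverRatFun_X_zero,
      map_mul, Polynomial.C_mul]

theorem derivative_polyOverRatFun (P : MvPolynomial (Fin 2) ℂ) :
    (polyOverRatFun P).derivative = polyOverRatFun (MvPolynomial.pderiv 1 P) := by
  induction P using MvPolynomial.induction_on with
  | C a => rw [polyOverRatFun_C, Polynomial.derivative_C, MvPolynomial.pderiv_C, map_zero]
  | add p q hp hq => rw [map_add, map_add, map_add, map_add, hp, hq]
  | mul_X p j hp =>
    rw [map_mul, Polynomial.derivative_mul, hp, MvPolynomial.pderiv_mul, map_add, map_mul, map_mul]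
    obtain rfl | rfl : j = 0 ∨ j = 1 := by fin_cases j <;> simp
    · rw [polyOverRatFun_X_zero, Polynomial.derivative_C,
        MvPolynomial.pderiv_X_of_ne (by simp), map_zero]
    · rw [polyOverRatFun_X_one, Polynomial.derivative_X, MvPolynomial.pderiv_X_self, map_one]

/-- The field of rational functions in one variable. -/
abbrev RatFun1 : Type := FractionRing (MvPolynomial (Fin 1) ℂ)

/-- For polynomials `p` and `q` with invertible Jacobian determinant, `y` lies in the field
`ℂ(p,q,x)`. -/
theorem exists_mul_X_one_eq (p q : MvPolynomial (Fin 2) ℂ) (hpq : IsUnit (jac p q)) :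
    ∃ a ∈ Algebra.adjoin ℂ {p, q, MvPolynomial.X 0},
    ∃ b ∈ Algebra.adjoin ℂ {p, q, MvPolynomial.X 0}, b ≠ 0 ∧ b * MvPolynomial.X 1 = a := by
  have : CharZero RatFun1 := charZero_of_injective_algebraMap
    (IsFractionRing.injective (MvPolynomial (Fin 1) ℂ) (FractionRing (MvPolynomial (Fin 1) ℂ)))
  let S := Algebra.adjoin ℂ {p, q, (MvPolynomial.X 0 : MvPolynomial (Fin 2) ℂ)}
  have hpS : p ∈ S := Algebra.subset_adjoin (by simp)
  have hqS : q ∈ S := Algebra.subset_adjoin (by simp)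
  have hxS : MvPolynomial.X 0 ∈ S := Algebra.subset_adjoin (by simp)
  let ι : MvPolynomial (Fin 2) ℂ →+* FractionRing (Polynomial RatFun1) := (algebraMap (Polynomial RatFun1) (FractionRing (Polynomial RatFun1))).comp polyOverRatFun
  have hι : Function.Injective ι :=
    (IsFractionRing.injective (Polynomial RatFun1) (FractionRing (Polynomial RatFun1))).comp polyOverRatFun_injective
  have hι0 : ∀ {a}, a ≠ 0 → ι a ≠ 0 := fun h => (map_ne_zero_iff ι hι).2 h
  -- The Jacobian identity is a Bézout relation between the y-derivatives, with the x-derivatives as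
  -- coefficients.
  have hcop : IsCoprime (polyOverRatFun p).derivative (polyOverRatFun q).derivative := by
    obtain ⟨e, he⟩ := (hpq.map polyOverRatFun).exists_left_inv
    rw [jac_eq, map_sub, map_mul, map_mul] at he
    rw [derivative_polyOverRatFun, derivative_polyOverRatFun]
    refine ⟨-(e * polyOverRatFun (MvPolynomial.pderiv 0 q)),
      e * polyOverRatFun (MvPolynomial.pderiv 0 p), ?_⟩
    linear_combination he
  have hX := X_mem_of_isCoprime_derivative (E := FractionRing (Polynomial RatFun1)) (IntermediateField.adjoin RatFun1 {ι p, ι q})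
    (polyOverRatFun p) (polyOverRatFun q) (IntermediateField.subset_adjoin _ _ (by simp [ι]))
    (IntermediateField.subset_adjoin _ _ (by simp [ι])) hcop
  have hX' : algebraMap (Polynomial RatFun1) (FractionRing (Polynomial RatFun1)) Polynomial.X = ι (MvPolynomial.X 1) := by
    simp only [ι, RingHom.comp_apply, polyOverRatFun_X_one]
  rw [hX', IntermediateField.mem_adjoin_iff_div] at hX
  have hren : ∀ m : MvPolynomial (Fin 1) ℂ, MvPolynomial.rename (fun _ => (0 : Fin 2)) m ∈ S := by
    intro m
    induction m using MvPolynomial.induction_on with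
    | C a =>
      rw [MvPolynomial.rename_C]
      exact S.algebraMap_mem a
    | add p q hp hq =>
      rw [map_add]
      exact add_mem hp hq
    | mul_X p j hp =>
      rw [map_mul, MvPolynomial.rename_X]
      exact mul_mem hp hxS
  -- Denominators in ℂ[x] are cleared, turning scalars from ℂ(x) into fractions over ℂ[p,q,x].
  have key : ∀ r ∈ Algebra.adjoin RatFun1 {ι p, ι q}, ∃ a ∈ S, ∃ b ∈ S, b ≠ 0 ∧ ι b * r = ι a := by
    intro r hr
    induction hr using Algebra.adjoin_induction with
    | mem r hr =>
      rcases hr with rfl | rfl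
      · exact ⟨p, hpS, 1, one_mem _, one_ne_zero, by simp⟩
      · exact ⟨q, hqS, 1, one_mem _, one_ne_zero, by simp⟩
    | algebraMap c =>
      obtain ⟨m, n, hn, rfl⟩ := IsFractionRing.div_surjective (A := MvPolynomial (Fin 1) ℂ) c
      have hιr : ∀ m : MvPolynomial (Fin 1) ℂ, ι (MvPolynomial.rename (fun _ => 0) m) =
          algebraMap RatFun1 (FractionRing (Polynomial RatFun1)) (algebraMap (MvPolynomial (Fin 1) ℂ) RatFun1 m) := by
        intro m
        simp only [ι, RingHom.comp_apply, polyOverRatFun_rename]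
        rw [← Polynomial.algebraMap_eq, ← IsScalarTower.algebraMap_apply]
      have hn0 : n ≠ 0 := nonZeroDivisors.ne_zero hn
      refine ⟨_, hren m, _, hren n, ?_, ?_⟩
      · rw [Ne, map_eq_zero_iff _ (MvPolynomial.rename_injective _
          (Function.injective_of_subsingleton _))]
        exact hn0
      · rw [hιr, hιr, ← map_mul, mul_div_cancel₀]
        exact (map_ne_zero_iff _ (IsFractionRing.injective (MvPolynomial (Fin 1) ℂ) RatFun1)).2 hn0
    | add r s _ _ hr hs =>
      obtain ⟨a, ha, b, hb, hb0, h⟩ := hr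
      obtain ⟨a', ha', b', hb', hb0', h'⟩ := hs
      refine ⟨b' * a + b * a', add_mem (mul_mem hb' ha) (mul_mem hb ha'), b * b', mul_mem hb hb',
        mul_ne_zero hb0 hb0', ?_⟩
      simp only [map_mul, map_add]
      linear_combination ι b' * h + ι b * h'
    | mul r s _ _ hr hs =>
      obtain ⟨a, ha, b, hb, hb0, h⟩ := hr
      obtain ⟨a', ha', b', hb', hb0', h'⟩ := hs
      refine ⟨a * a', mul_mem ha ha', b * b', mul_mem hb hb', mul_ne_zero hb0 hb0', ?_⟩
      simp only [map_mul]
      linear_combination ι b' * s * h + ι a * h'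
  obtain ⟨r, hr, s, hs, hrs⟩ := hX
  obtain ⟨a, ha, b, hb, hb0, h⟩ := key r hr
  obtain ⟨a', ha', b', hb', hb0', h'⟩ := key s hs
  have hs0 : s ≠ 0 := by
    rintro rfl
    rw [div_zero] at hrs
    exact hι0 (MvPolynomial.X_ne_zero 1) hrs
  have ha0' : a' ≠ 0 := by
    rintro rfl
    rw [map_zero] at h'
    exact mul_ne_zero (hι0 hb0') hs0 h'
  refine ⟨b' * a, mul_mem hb' ha, a' * b, mul_mem ha' hb, mul_ne_zero ha0' hb0, hι ?_⟩
  rw [eq_div_iff hs0] at hrs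
  simp only [map_mul]
  linear_combination (-(ι b * ι (MvPolynomial.X 1))) * h' + ι b' * h + ι b * ι b' * hrs

/-- If the Jacobian determinant of `f` is invertible, then `y` is a fraction with numerator in
`ℂ[f(x),f(y),x]` and denominator in `ℂ[f(x),f(y)]`. -/
theorem exists_mul_X_one_eq_eval₂ (f : MvPolynomial (Fin 2) ℂ →ₐ[ℂ] MvPolynomial (Fin 2) ℂ)
    (hf : IsUnit (jac (f (MvPolynomial.X 0)) (f (MvPolynomial.X 1)))) :
    ∃ (V : MvPolynomial (Fin 2) ℂ) (U : Polynomial (MvPolynomial (Fin 2) ℂ)), V ≠ 0 ∧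
      f V * MvPolynomial.X 1 = U.eval₂ (f : _ →+* _) (MvPolynomial.X 0) := by
  obtain ⟨a, ha, b, hb, hb0, hab⟩ := exists_mul_X_one_eq _ _ hf
  obtain ⟨F, hF0, hF⟩ := exists_eval₂_eq_zero f (injective_of_jac_ne_zero f hf.ne_zero) b
  -- Removing powers of T leaves a relation for `b` with nonzero constant term, which exhibits a
  -- nonzero element of ℂ[p,q] as a multiple of `b`.
  obtain ⟨G, hG, hGX⟩ := Polynomial.exists_eq_pow_rootMultiplicity_mul_and_not_dvd F hF0 0
  rw [Polynomial.C_0, sub_zero] at hG hGX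
  have hGb : G.eval₂ (f : _ →+* _) b = 0 := by
    rw [hG, Polynomial.eval₂_mul, Polynomial.eval₂_pow, Polynomial.eval₂_X] at hF
    exact (mul_eq_zero.1 hF).resolve_left (pow_ne_zero _ hb0)
  rw [← Polynomial.divX_mul_X_add G, Polynomial.eval₂_add, Polynomial.eval₂_mul,
    Polynomial.eval₂_X, Polynomial.eval₂_C, RingHom.coe_coe] at hGb
  have hmem : -(G.divX.eval₂ (f : _ →+* _) b) * a ∈
      Algebra.adjoin ℂ {f (MvPolynomial.X 0), f (MvPolynomial.X 1), MvPolynomial.X 0} := by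
    refine mul_mem (neg_mem (eval₂_mem _ f ?_ hb _)) ha
    rw [range_eq_adjoin_pair]
    exact Algebra.adjoin_mono (by intro; simp; tauto)
  obtain ⟨U, hU⟩ := (mem_adjoin_triple_iff f _ _).1 hmem
  refine ⟨G.coeff 0, U, fun h => hGX (Polynomial.X_dvd_iff.2 h), ?_⟩
  rw [hU]
  linear_combination MvPolynomial.X 1 * hGb - G.divX.eval₂ (f : _ →+* _) b * hab

/-! ### Fractions over ℂ[p,q] and quotient presentations -/

/-- Membership in `ℂ(p,q)` means being a fraction of elements of `ℂ[p,q]`. -/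
theorem exists_mul_eq_of_mem_fieldPQ (f : MvPolynomial (Fin 2) ℂ →ₐ[ℂ] MvPolynomial (Fin 2) ℂ)
    {w : MvPolynomial (Fin 2) ℂ}
    (hw : toRat w ∈ fieldPQ (f (MvPolynomial.X 0)) (f (MvPolynomial.X 1))) :
    ∃ d a : MvPolynomial (Fin 2) ℂ, d ≠ 0 ∧ f d * w = f a := by
  have hinj : Function.Injective toRat := IsFractionRing.injective _ _
  let φ : MvPolynomial (Fin 2) ℂ →ₐ[ℂ] RatFun2 := (IsScalarTower.toAlgHom ℂ _ _).comp f
  have hadj : Algebra.adjoin ℂ {toRat (f (MvPolynomial.X 0)), toRat (f (MvPolynomial.X 1))} =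
    φ.range := (range_eq_adjoin_pair φ).symm
  rw [fieldPQ, IntermediateField.mem_adjoin_iff_div, hadj] at hw
  obtain ⟨_, ⟨a, rfl⟩, _, ⟨d, rfl⟩, h⟩ := hw
  change toRat w = toRat (f a) / toRat (f d) at h
  -- Division by zero yields zero, so here `w = 0`, presented as 0/1.
  by_cases hd : f d = 0
  · refine ⟨1, 0, one_ne_zero, hinj ?_⟩
    rw [map_one, one_mul, h, hd]
    simp [toRat]
  · refine ⟨d, a, fun h0 => hd (by rw [h0, map_zero]), hinj ?_⟩
    have hd' : toRat (f d) ≠ 0 := (map_ne_zero_iff _ hinj).2 hd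
    rw [eq_div_iff hd'] at h
    rw [toRat, map_mul, ← h, mul_comm]

theorem isQuotientPresentation_iff (f : MvPolynomial (Fin 2) ℂ →ₐ[ℂ] MvPolynomial (Fin 2) ℂ)
    (hf : Function.Injective f) {w h : MvPolynomial (Fin 2) ℂ} (hh : h ≠ 0)
    (u v : MvPolynomial (Fin 2) ℂ) :
    IsQuotientPresentation (f (MvPolynomial.X 0)) (f (MvPolynomial.X 1)) w h u v ↔
      ∃ (V : MvPolynomial (Fin 2) ℂ) (U : Polynomial (MvPolynomial (Fin 2) ℂ)),
        V ≠ 0 ∧ f V = v ∧ U.eval₂ (f : _ →+* _) w = u ∧ v * h = u := by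
  have hinj : Function.Injective toRat := IsFractionRing.injective _ _
  constructor
  · rintro ⟨hu, -, hv, hv0, heq⟩
    rw [← range_eq_adjoin_pair] at hv
    obtain ⟨V, hV⟩ := hv
    change f V = v at hV
    subst hV
    obtain ⟨U, rfl⟩ := (mem_adjoin_triple_iff f _ _).1 hu
    refine ⟨V, U, ?_, rfl, rfl, hinj ?_⟩
    · rintro rfl
      exact hv0 (map_zero f)
    · have hv' : toRat (f V) ≠ 0 := (map_ne_zero_iff _ hinj).2 hv0
      rw [eq_div_iff hv'] at heq
      change toRat (f V * h) = _
      rw [← heq, toRat, map_mul, mul_comm]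
  · rintro ⟨V, U, hV, rfl, rfl, heq⟩
    have hv0 : f V ≠ 0 := (map_ne_zero_iff f hf).2 hV
    have hv' : toRat (f V) ≠ 0 := (map_ne_zero_iff _ hinj).2 hv0
    refine ⟨(mem_adjoin_triple_iff f _ _).2 ⟨U, rfl⟩, ?_, ?_, hv0, ?_⟩
    · rw [← heq]
      exact mul_ne_zero hv0 hh
    · rw [← range_eq_adjoin_pair]
      exact ⟨V, rfl⟩
    · rw [eq_div_iff hv', ← heq, toRat, toRat, toRat, map_mul, mul_comm]

/-! ### The derivative of the minimal relation and the main theorem -/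

/-- The derivative of the minimal relation of `g(x)` over `ℂ[f(x),f(y)]` divides a power of `v`
whenever `g(y) = u / v`. -/
theorem exists_dvd_pow_of_mul_eq (f : MvPolynomial (Fin 2) ℂ →ₐ[ℂ] MvPolynomial (Fin 2) ℂ)
    (hf : IsUnit (jac (f (MvPolynomial.X 0)) (f (MvPolynomial.X 1))))
    (γ : MvPolynomial (Fin 2) ℂ →ₐ[ℂ] MvPolynomial (Fin 2) ℂ) (hγ : Function.Surjective γ)
    (V : MvPolynomial (Fin 2) ℂ)
    (U F : Polynomial (MvPolynomial (Fin 2) ℂ))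
    (hU : f V * γ (MvPolynomial.X 1) = U.eval₂ (f : _ →+* _) (γ (MvPolynomial.X 0)))
    (hF : F.eval₂ (f : _ →+* _) (γ (MvPolynomial.X 0)) = 0)
    (hmin : ∀ G : Polynomial (MvPolynomial (Fin 2) ℂ),
      G.eval₂ (f : _ →+* _) (γ (MvPolynomial.X 0)) = 0 → F ∣ G) :
    ∃ N, F.derivative.eval₂ (f : _ →+* _) (γ (MvPolynomial.X 0)) ∣ f V ^ N := by
  set x := γ (MvPolynomial.X 0) with hx
  set δ := F.derivative.eval₂ (f : _ →+* _) x with hδ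
  set W := U.derivative.eval₂ (f : _ →+* _) x with hW
  have key : ∀ P Q, γ P = f Q → ∃ N, δ ∣ f V ^ N * (f V * γ (MvPolynomial.pderiv 0 P) +
      γ (MvPolynomial.pderiv 1 P) * W) := by
    intro P Q hPQ
    obtain ⟨N, G, h1, h2⟩ := exists_lift_of_mul_eq f γ V U hU P
    -- The lift of P minus the constant V^N Q vanishes at g(x), hence is a multiple of `F`; its
    -- derivative there is a multiple of δ.
    obtain ⟨H, hH⟩ := hmin (G - Polynomial.C (V ^ N * Q)) (by
      rw [Polynomial.eval₂_sub]
      refine sub_eq_zero.2 (h1.trans ?_)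
      rw [Polynomial.eval₂_C, hPQ, RingHom.coe_coe, map_mul, map_pow])
    have h3 := congrArg (fun P => (Polynomial.derivative P).eval₂ (f : _ →+* _) x) hH
    simp only [Polynomial.derivative_sub, Polynomial.derivative_C, sub_zero,
      Polynomial.derivative_mul, Polynomial.eval₂_add, Polynomial.eval₂_mul, hF, zero_mul,
      add_zero] at h3
    refine ⟨N, ?_⟩
    refine (Dvd.intro_left (f V * H.eval₂ (f : _ →+* _) x) ?_).trans (dvd_of_eq h2)
    rw [h3]
    ring
  obtain ⟨P, hP⟩ := hγ (f (MvPolynomial.X 0))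
  obtain ⟨Q, hQ⟩ := hγ (f (MvPolynomial.X 1))
  obtain ⟨N, hN⟩ := key P _ hP
  obtain ⟨N', hN'⟩ := key Q _ hQ
  have hunit : IsUnit (γ (jac P Q)) := by
    rw [← hP, ← hQ, jac_algHom γ] at hf
    exact isUnit_of_mul_isUnit_left hf
  refine ⟨N + N' + 1, hunit.dvd_mul_right.1 ?_⟩
  rw [jac_eq]
  simp only [map_sub, map_mul]
  -- This combination eliminates `W` and leaves f(V)^(N+N'+1) times the invertible γ(jac P Q).
  have h4 := dvd_sub
    (hN.mul_left (f V ^ N' * γ (MvPolynomial.pderiv 1 Q)))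
    (hN'.mul_left (f V ^ N * γ (MvPolynomial.pderiv 1 P)))
  refine h4.trans (dvd_of_eq ?_)
  ring

theorem theorem4p1
    (f : MvPolynomial (Fin 2) ℂ →ₐ[ℂ] MvPolynomial (Fin 2) ℂ)
    (p q : MvPolynomial (Fin 2) ℂ)
    (hp : p = f (MvPolynomial.X 0)) (hq : q = f (MvPolynomial.X 1))
    (hjac : ∃ c : ℂ, c ≠ 0 ∧ jac p q = MvPolynomial.C c)
    (g : MvPolynomial (Fin 2) ℂ ≃ₐ[ℂ] MvPolynomial (Fin 2) ℂ)
    (g₁ g₂ : MvPolynomial (Fin 2) ℂ)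
    (hg₁ : g₁ = g (MvPolynomial.X 0)) (hg₂ : g₂ = g (MvPolynomial.X 1)) :
    (∃ u v : MvPolynomial (Fin 2) ℂ, IsQuotientPresentation p q g₁ g₂ u v) ∧
    ∀ u v : MvPolynomial (Fin 2) ℂ, IsQuotientPresentation p q g₁ g₂ u v →
      (∀ a : (ringInv p q g₁ v)ˣ,
        ((a : ringInv p q g₁ v) : RatFun2) ∈ (fieldPQ p q : Set RatFun2) \ {0}) →
      Function.Bijective f := by
  subst hp hq
  have hf : IsUnit (jac (f (MvPolynomial.X 0)) (f (MvPolynomial.X 1))) := by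
    obtain ⟨c, hc, h⟩ := hjac
    rw [h]
    exact (IsUnit.mk0 c hc).map MvPolynomial.C
  have hinj := injective_of_jac_ne_zero f hf.ne_zero
  have hg₂0 : g₂ ≠ 0 := by
    rw [hg₂]
    exact (map_ne_zero_iff g g.injective).2 (MvPolynomial.X_ne_zero 1)
  have hpres := isQuotientPresentation_iff f hinj (w := g₁) hg₂0
  refine ⟨?_, fun u v huv hunits => ⟨hinj, ?_⟩⟩
  · let γ : MvPolynomial (Fin 2) ℂ →ₐ[ℂ] MvPolynomial (Fin 2) ℂ := g
    -- Composing with g⁻¹ reduces to g₁ = x and g₂ = y; applying g carries the fraction back.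
    let f' : MvPolynomial (Fin 2) ℂ →ₐ[ℂ] MvPolynomial (Fin 2) ℂ :=
      (g.symm : MvPolynomial (Fin 2) ℂ →ₐ[ℂ] MvPolynomial (Fin 2) ℂ).comp f
    have hγf : ∀ a, γ (f' a) = f a := fun a => g.apply_symm_apply (f a)
    have hf' : IsUnit (jac (f' (MvPolynomial.X 0)) (f' (MvPolynomial.X 1))) := by
      rw [← hγf, ← hγf, jac_algHom γ] at hf
      exact (MulEquiv.isUnit_map g).1 (isUnit_of_mul_isUnit_left hf)
    obtain ⟨V, U, hV, hVU⟩ := exists_mul_X_one_eq_eval₂ f' hf'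
    refine ⟨_, _, (hpres _ _).2 ⟨V, U, hV, rfl, rfl, ?_⟩⟩
    have h := congrArg (γ : _ →+* MvPolynomial (Fin 2) ℂ) hVU
    rw [map_mul, Polynomial.hom_eval₂] at h
    have hcomp : (γ : _ →+* MvPolynomial (Fin 2) ℂ).comp
        (f' : _ →+* MvPolynomial (Fin 2) ℂ) =
        (f : MvPolynomial (Fin 2) ℂ →+* MvPolynomial (Fin 2) ℂ) := RingHom.ext hγf
    rw [hcomp] at h
    rw [hg₁, hg₂, ← hγf]
    exact h
  · obtain ⟨V, U, hV, rfl, rfl, hVU⟩ := (hpres _ _).1 huv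
    have hv0 : f V ≠ 0 := huv.den_ne_zero
    obtain ⟨F, hF0, hF, hmin⟩ := exists_generator_of_eval₂_eq_zero
      (f : MvPolynomial (Fin 2) ℂ →+* MvPolynomial (Fin 2) ℂ) hinj g₁
      (exists_eval₂_eq_zero f hinj g₁)
    obtain ⟨N, k, hk⟩ := exists_dvd_pow_of_mul_eq f hf (g : _ →ₐ[ℂ] _) g.surjective V U F
      (by rw [hg₁, hg₂] at hVU; exact hVU) (by rw [hg₁] at hF; exact hF)
      (by rw [hg₁] at hmin; exact hmin)
    replace hk : f V ^ N = F.derivative.eval₂ (f : _ →+* _) g₁ * k := by rw [hg₁]; exact hk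
    set δ := F.derivative.eval₂ (f : _ →+* _) g₁ with hδ
    have hrange : ∀ S : Subalgebra ℂ (MvPolynomial (Fin 2) ℂ), g₁ ∈ S → g₂ ∈ S →
        ∀ b, b ∈ S := by
      intro S h₁ h₂ b
      have h3 : (g : MvPolynomial (Fin 2) ℂ →ₐ[ℂ] MvPolynomial (Fin 2) ℂ).range ≤ S := by
        rw [range_eq_adjoin_pair, Algebra.adjoin_le_iff]
        rintro _ (rfl | rfl)
        · rw [hg₁] at h₁; exact h₁
        · rw [hg₂] at h₂; exact h₂
      exact h3 (g.surjective b)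
    let τ : MvPolynomial (Fin 2) ℂ →ₐ[ℂ] RatFun2 := IsScalarTower.toAlgHom ℂ _ _
    let A := ringInv (f (MvPolynomial.X 0)) (f (MvPolynomial.X 1)) g₁ (f V)
    -- All of ℂ[x,y] = ℂ[g₁,g₂] lies in `A`, because g₂ = u/v does.
    have hmemA : ∀ b, toRat b ∈ A := by
      have h₁ : toRat g₁ ∈ A := Algebra.subset_adjoin (by simp)
      refine hrange (A.comap τ) h₁ ?_
      change toRat g₂ ∈ A
      rw [huv.eq_div, div_eq_mul_inv]
      refine mul_mem ?_ (Algebra.subset_adjoin (by simp))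
      refine eval₂_mem (A.comap τ) f ?_ h₁ U
      rw [range_eq_adjoin_pair, Algebra.adjoin_le_iff]
      rintro _ (rfl | rfl)
      · exact Algebra.subset_adjoin (s := {toRat _, toRat _, toRat _, _}) (Or.inl rfl)
      · exact Algebra.subset_adjoin (s := {toRat _, toRat _, toRat _, _}) (Or.inr (Or.inl rfl))
    have hvA : (toRat (f V))⁻¹ ∈ A := Algebra.subset_adjoin (by simp)
    have hv' : toRat (f V) ≠ 0 :=
      (map_ne_zero_iff _ (IsFractionRing.injective (MvPolynomial (Fin 2) ℂ) RatFun2)).2 hv0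
    have hone : toRat δ * (toRat k * (toRat (f V))⁻¹ ^ N) = 1 := by
      rw [← mul_assoc, inv_pow, mul_inv_eq_one₀ (pow_ne_zero _ hv'), toRat, toRat, toRat,
        ← map_mul, ← hk, map_pow]
    let a : Aˣ := Units.mkOfMulEqOne ⟨toRat δ, hmemA δ⟩
      ⟨toRat k * (toRat (f V))⁻¹ ^ N, mul_mem (hmemA k) (pow_mem hvA N)⟩ (Subtype.ext hone)
    have hδmem : toRat δ ∈ fieldPQ (f (MvPolynomial.X 0)) (f (MvPolynomial.X 1)) := (hunits a).1
    obtain ⟨d, e, hd, hde⟩ := exists_mul_eq_of_mem_fieldPQ f hδmem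
    have hdeg : F.natDegree ≤ 1 := by
      by_contra! hlt
      -- With δ = e/d in ℂ(p,q), the polynomial dF' − e vanishes at g₁ but has degree one less than
      -- `F`.
      have hnat : (Polynomial.C d * F.derivative - Polynomial.C e).natDegree = F.natDegree - 1 := by
        rw [Polynomial.natDegree_sub_C, Polynomial.natDegree_C_mul hd,
          Polynomial.natDegree_derivative]
      have hle := Polynomial.natDegree_le_of_dvd
        (hmin (Polynomial.C d * F.derivative - Polynomial.C e) (by
          rw [Polynomial.eval₂_sub, Polynomial.eval₂_mul, Polynomial.eval₂_C, Polynomial.eval₂_C]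
          exact sub_eq_zero.2 hde))
        (fun h0 => by rw [h0, Polynomial.natDegree_zero] at hnat; omega)
      omega
    obtain ⟨r, s, rfl⟩ := Polynomial.exists_eq_X_add_C_of_natDegree_le_one hdeg
    simp only [Polynomial.eval₂_add, Polynomial.eval₂_mul, Polynomial.eval₂_C,
      Polynomial.eval₂_X, RingHom.coe_coe] at hF
    have hr : r ≠ 0 := by
      rintro rfl
      simp only [map_zero, zero_mul, zero_add, map_eq_zero_iff f hinj] at hF
      exact hF0 (by simp [hF])
    have h₁ : g₁ ∈ f.range := mem_range_of_mul_eq f hf (a := -s) hr (by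
      rw [map_neg]; exact eq_neg_of_add_eq_zero_left hF)
    obtain ⟨w, hw⟩ := eval₂_mem f.range f le_rfl h₁ U
    have h₂ : g₂ ∈ f.range := mem_range_of_mul_eq f hf (a := w) hV (hVU.trans hw.symm)
    exact fun b => hrange f.range h₁ h₂ b
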